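/- Let $0<p<1/2$ and $\hat p=\frac{p}{1-p}\in(0,1)$. The non-backtracking branching random walk $\mathrm{NBBRW}(p)$ is the following discrete-time Markov process on configurations of finitely many particles located at sites of $\mathbb Z_{\ge 0}=\{0,1,2,\dots\}$, each particle having Type 1, 2 or 3. At each time step all particles act independently of each other and of the past. A particle at $0$ stays there forever and produces no offspring (it is killed at the origin). A particle at $x\ge 1$ dies and is replaced by its offspring, as follows: a Type-1 or Type-3 particle produces a single Type-1 offspring with probability $\hat p$, and otherwise, with probability $1-\hat p$, it produces one Type-2 offspring together with a $\mathrm{Poisson}(1)$-distributed number of Type-3 offspring; a Type-2 particle always produces one Type-2 offspring together with a $\mathrm{Poisson}(1)$-distributed number of Type-3 offspring. Offspring of Type 1 are placed at $x-1$, and offspring of Types 2 and 3 are placed at $x+1$. Let $V\in\{0,1,2,\dots\}\cup\{\infty\}$ be the total number of particles that are ever killed at the origin. For a given initial configuration, the process is called recurrent if $\mathbf P(V=\infty)=1$, and transient otherwise. Lemma. Suppose that the initial configuration is finite and contains at least one Type-2 particle located at a site $x\ge 1$. Then $\mathrm{NBBRW}(p)$ is transient if and only if $p\le 1/6$. -/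

import Mathlib

open MeasureTheory ProbabilityTheory
open scoped ENNReal

/-- The three particle types. -/
inductive PType : Type
  | one
  | two
  | three
  deriving DecidableEq

/-- A particle is a pair (type, site), with sites in `{0, 1, 2, …}`. -/
abbrev Particle : Type := PType × ℕ

/-- A finite configuration of particles, as a finite multiset of typed particles. -/
abbrev Config : Type := Multiset Particle

namespace NBBRW

/-- The countable set of configurations carries the discrete σ-algebra. -/
instance instMeasurableSpaceConfig : MeasurableSpace Config := ⊤

instance instDiscreteMeasurableSpaceConfig : DiscreteMeasurableSpace Config where
  forall_measurableSet _ := trivial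

/-- The probability `p̂ = p / (1 - p)`. -/
noncomputable def pHat (p : ℝ) : ℝ := p / (1 - p)

theorem pHat_nonneg {p : ℝ} (hp : p ∈ Set.Ioo (0 : ℝ) (1 / 2)) : 0 ≤ pHat p :=
  div_nonneg hp.1.le (by linarith [hp.2])

theorem pHat_le_one {p : ℝ} (hp : p ∈ Set.Ioo (0 : ℝ) (1 / 2)) : pHat p ≤ 1 := by
  have h : (0 : ℝ) < 1 - p := by linarith [hp.2]
  rw [pHat, div_le_one h]
  linarith [hp.2]

/-- A coin that shows `true` with probability `p̂` and `false` with probability `1 - p̂`. -/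
noncomputable def coin (p : ℝ) (hp : p ∈ Set.Ioo (0 : ℝ) (1 / 2)) : PMF Bool :=
  PMF.ofFintype
    (fun b => if b then ENNReal.ofReal (pHat p) else ENNReal.ofReal (1 - pHat p)) (by
      have h := ENNReal.ofReal_add (pHat_nonneg hp) (sub_nonneg.2 (pHat_le_one hp))
      simp only [Fintype.sum_bool]
      simpa using h.symm)

/-- One Type-2 offspring together with a `Poi(1)`-distributed number of Type-3 offspring. -/
noncomputable def turnedOffspring : PMF (Multiset PType) :=
  (poissonMeasure 1).toPMF.map fun n => PType.two ::ₘ Multiset.replicate n PType.three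

/-- The law of the types of the offspring of a particle of a given type (located at a positive
site).  Types 1 and 3: a single Type-1 offspring with probability `p̂`, otherwise one Type-2
offspring and `Poi(1)` Type-3 offspring.  Type 2: one Type-2 offspring and `Poi(1)` Type-3
offspring. -/
noncomputable def offspring (p : ℝ) (hp : p ∈ Set.Ioo (0 : ℝ) (1 / 2)) :
    PType → PMF (Multiset PType)
  | PType.one => (coin p hp).bind fun b =>
      if b then PMF.pure {PType.one} else turnedOffspring
  | PType.two => turnedOffspring
  | PType.three => (coin p hp).bind fun b =>
      if b then PMF.pure {PType.one} else turnedOffspring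

/-- The (deterministic) displacement of a newborn particle that is born at site `x`: Type-1
particles move one step to the left, Type-2 and Type-3 particles one step to the right. -/
def displace (x : ℕ) : PType → ℕ
  | PType.one => x - 1
  | PType.two => x + 1
  | PType.three => x + 1

/-- The law of what a single particle is replaced by in one time step: a particle at `0` stays
there forever without offspring; a particle at `x ≥ 1` dies and is replaced by its displaced
offspring. -/
noncomputable def particleStep (p : ℝ) (hp : p ∈ Set.Ioo (0 : ℝ) (1 / 2)) (z : Particle) :
    PMF Config :=
  if z.2 = 0 then PMF.pure {z}
  else (offspring p hp z.1).map fun s => s.map fun j => (j, displace z.2 j)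

/-- The law of the sum of a configuration with law `particleStep p hp z` and an independent
configuration with law `μ`. -/
noncomputable def addParticleStep (p : ℝ) (hp : p ∈ Set.Ioo (0 : ℝ) (1 / 2)) (z : Particle)
    (μ : PMF Config) : PMF Config :=
  (particleStep p hp z).bind fun a => μ.bind fun b => PMF.pure (a + b)

instance instLeftCommutative (p : ℝ) (hp : p ∈ Set.Ioo (0 : ℝ) (1 / 2)) :
    LeftCommutative (addParticleStep p hp) where
  left_comm z w μ := by
    simp only [addParticleStep, PMF.bind_bind, PMF.pure_bind]
    rw [PMF.bind_comm]
    simp only [add_left_comm]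

/-- One time step from the configuration `ω`: all particles act independently, and the new
configuration is the union (sum of multisets) of what they are replaced by. -/
noncomputable def step (p : ℝ) (hp : p ∈ Set.Ioo (0 : ℝ) (1 / 2)) (ω : Config) : PMF Config :=
  Multiset.foldr (addParticleStep p hp) (PMF.pure 0) ω

/-- The time-`n` transition kernel of the Markov chain: given the trajectory `ω(0), …, ω(n)`, the
law of `ω(n + 1)` is `step p hp (ω(n))`. -/
noncomputable def transition (p : ℝ) (hp : p ∈ Set.Ioo (0 : ℝ) (1 / 2)) (n : ℕ) :
    Kernel ((_ : Finset.Iic n) → Config) Config where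
  toFun h := (step p hp (h ⟨n, Finset.mem_Iic.2 le_rfl⟩)).toMeasure
  measurable' :=
    (Measurable.of_discrete (f := fun ω : Config => (step p hp ω).toMeasure)).comp
      (measurable_pi_apply _)

instance instIsMarkovKernelTransition (p : ℝ) (hp : p ∈ Set.Ioo (0 : ℝ) (1 / 2)) (n : ℕ) :
    IsMarkovKernel (transition p hp n) where
  isProbabilityMeasure h :=
    PMF.toMeasure.isProbabilityMeasure (step p hp (h ⟨n, Finset.mem_Iic.2 le_rfl⟩))

/-- The law, on trajectories `(ω(0), ω(1), …)`, of the process started from the configuration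
`ω₀`. -/
noncomputable def law (p : ℝ) (hp : p ∈ Set.Ioo (0 : ℝ) (1 / 2)) (ω₀ : Config) :
    Measure (ℕ → Config) :=
  Kernel.trajMeasure (X := fun _ => Config) (Measure.dirac ω₀) (transition p hp)

/-- The total number of particles that are ever stopped (killed) at `0`.  Stopped particles stay
at `0` forever, so this is the supremum over `t` of the number of particles at `0` at time `t`. -/
noncomputable def V (path : ℕ → Config) : ℕ∞ :=
  ⨆ t : ℕ, ((path t).countP (fun z => z.2 = 0) : ℕ∞)

/-- The process started from `ω₀` is recurrent if almost surely infinitely many particles are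
killed at the origin. -/
def Recurrent (p : ℝ) (hp : p ∈ Set.Ioo (0 : ℝ) (1 / 2)) (ω₀ : Config) : Prop :=
  law p hp ω₀ {path | V path = ⊤} = 1

/-- The process is transient if it is not recurrent. -/
def Transient (p : ℝ) (hp : p ∈ Set.Ioo (0 : ℝ) (1 / 2)) (ω₀ : Config) : Prop :=
  ¬ Recurrent p hp ω₀

end NBBRW

/-! Put `q = pHat p`; then `p ≤ 1/6` means `q ≤ 1/5`. The threshold is where the discriminant `(5q -
1)(q - 1)` of `(2 - q)t² - (1 + q)t + q` changes sign.

Recurrence, `q > 1/5`. Let `a x` and `b x` be the values of `E[2^(-V)]` started from one particle of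
Type 1, respectively Type 2, at `x`. They are decreasing limits of iterates of the one-step map
`genStep`, since independence makes expectations of products over particles multiplicative
(`expect_step_prod`). At positive sites the limits solve `b x = b (x+1) * exp (a (x+1) - 1)` and `a
(x+1) = q * a x + (1-q) * b (x+1)`, with `a 0 = 1/2`. If `b` were nonzero, then `-log b` would be
positive and decrease to `0`. Linearising there gives a recursion with the above characteristic
polynomial; without real roots it admits no positive decreasing solution (`no_log_fixed_point`). So
`b = 0` at positive sites, and one Type-2 particle there forces `V = ∞` almost surely.

Transience, `q ≤ 1/5`. At `q = 1/5` the polynomial has the double root `1/3`. The total weight of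
particles, `3^(-x)` for Type 2 and `2 * 3^(-x)` otherwise, is then a supermartingale dominating the
number of killed particles, so `V` has finite mean. -/

/-- The expectation of a nonnegative function under a probability mass function. -/
noncomputable def PMF.expect {α : Type*} (μ : PMF α) (f : α → ℝ≥0∞) : ℝ≥0∞ := ∑' a, μ a * f a

namespace PMF

variable {α β : Type*}

theorem expect_pure (a : α) (f : α → ℝ≥0∞) : (PMF.pure a).expect f = f a := by
  classical
  rw [expect, tsum_eq_single a]
  · simp
  · intro b hb
    simp [PMF.pure_apply, hb]

theorem expect_bind (μ : PMF α) (k : α → PMF β) (f : β → ℝ≥0∞) :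
    (μ.bind k).expect f = μ.expect fun a => (k a).expect f := by
  simp only [expect, PMF.bind_apply, ← ENNReal.tsum_mul_right, ← ENNReal.tsum_mul_left]
  rw [ENNReal.tsum_comm]
  simp only [mul_assoc]

theorem expect_map (μ : PMF α) (g : α → β) (f : β → ℝ≥0∞) :
    (μ.map g).expect f = μ.expect fun a => f (g a) := by
  rw [← PMF.bind_pure_comp, expect_bind]
  simp [expect_pure]

theorem expect_const (μ : PMF α) (c : ℝ≥0∞) : μ.expect (fun _ => c) = c := by
  rw [expect, ENNReal.tsum_mul_right, μ.tsum_coe, one_mul]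

theorem expect_const_mul (μ : PMF α) (c : ℝ≥0∞) (f : α → ℝ≥0∞) :
    (μ.expect fun a => c * f a) = c * μ.expect f := by
  simp only [expect, ← ENNReal.tsum_mul_left]
  exact tsum_congr fun a => mul_left_comm _ _ _

theorem expect_mul_const (μ : PMF α) (c : ℝ≥0∞) (f : α → ℝ≥0∞) :
    (μ.expect fun a => f a * c) = μ.expect f * c := by
  simp only [expect, ← ENNReal.tsum_mul_right, mul_assoc]

theorem expect_add (μ : PMF α) (f g : α → ℝ≥0∞) :
    (μ.expect fun a => f a + g a) = μ.expect f + μ.expect g := by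
  simp only [expect, mul_add, ENNReal.tsum_add]

theorem lintegral_toMeasure [Countable α] [MeasurableSpace α] [MeasurableSingletonClass α]
    (μ : PMF α) (f : α → ℝ≥0∞) : ∫⁻ a, f a ∂μ.toMeasure = μ.expect f := by
  rw [lintegral_countable', expect]
  exact tsum_congr fun a => by
    rw [μ.toMeasure_apply_singleton a (measurableSet_singleton a), mul_comm]

end PMF

/-! ### The Markov property of the trajectory law. -/

namespace NBBRW

variable (p : ℝ) (hp : p ∈ Set.Ioo (0 : ℝ) (1 / 2))

instance instCountablePType : Countable PType :=
  Function.Injective.countable (f := fun t : PType => match t with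
    | .one => (0 : ℕ)
    | .two => 1
    | .three => 2) (by intro a b; cases a <;> cases b <;> simp)

instance instCountableConfig : Countable Config :=
  Function.Surjective.countable (f := fun l : List Particle => (l : Config)) Quot.mk_surjective

instance instIsProbabilityMeasureLaw (ω₀ : Config) : IsProbabilityMeasure (law p hp ω₀) := by
  unfold law
  infer_instance

theorem law_map_zero (ω₀ : Config) :
    (law p hp ω₀).map (fun path => path 0) = Measure.dirac ω₀ := by
  have h : law p hp ω₀ = Kernel.traj (X := fun _ => Config) (transition p hp) 0
      (fun _ => ω₀) := by
    unfold law Kernel.trajMeasure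
    rw [Measure.map_dirac' (by fun_prop), Measure.dirac_bind (Kernel.measurable _)]
    congr
  have h2 := Kernel.traj_map_frestrictLe_apply (X := fun _ => Config)
    (κ := transition p hp) 0 0 (fun _ => ω₀)
  rw [← h, Kernel.partialTraj_self, Kernel.id_apply] at h2
  have h3 := congrArg (Measure.map fun y => y ⟨0, Finset.mem_Iic.2 le_rfl⟩) h2
  rw [Measure.map_map (by fun_prop) (by fun_prop), Measure.map_dirac' (by fun_prop)] at h3
  exact h3

/-- The one-step Markov property: the joint law of the path up to time `n` and its next state is the
composition-product with `transition`. -/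
theorem lintegral_law_pair (ω₀ : Config) (n : ℕ) (f : Config → Config → ℝ≥0∞) :
    ∫⁻ path, f (path n) (path (n + 1)) ∂law p hp ω₀
      = ∫⁻ path, (step p hp (path n)).expect (f (path n)) ∂law p hp ω₀ := by
  have h := Kernel.map_frestrictLe_trajMeasure_compProd_eq_map_trajMeasure
    (X := fun _ => Config) (μ₀ := Measure.dirac ω₀) (κ := transition p hp) (a := n)
  have hf : Measurable fun y : Config × Config => f y.1 y.2 := Measurable.of_discrete
  set g : ((_ : Finset.Iic n) → Config) × Config → ℝ≥0∞ :=
    fun y => f (y.1 ⟨n, Finset.mem_Iic.2 le_rfl⟩) y.2 with hg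
  have hgm : Measurable g := by
    have : Measurable fun y : ((_ : Finset.Iic n) → Config) × Config =>
      (y.1 ⟨n, Finset.mem_Iic.2 le_rfl⟩, y.2) := by fun_prop
    exact hf.comp this
  have h2 := congrArg (fun μ => ∫⁻ y, g y ∂μ) h
  rw [Measure.lintegral_compProd hgm, lintegral_map hgm (by fun_prop),
    lintegral_map hgm.lintegral_kernel_prod_right' (by fun_prop)] at h2
  refine h2.symm.trans (lintegral_congr fun path => ?_)
  exact PMF.lintegral_toMeasure _ _

/-- The one-step expectation operator. -/
noncomputable def nextExpect (f : Config → ℝ≥0∞) (ω : Config) : ℝ≥0∞ := (step p hp ω).expect f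

theorem lintegral_law (ω₀ : Config) (n : ℕ) (f : Config → ℝ≥0∞) :
    ∫⁻ path, f (path n) ∂law p hp ω₀ = (nextExpect p hp)^[n] f ω₀ := by
  induction n generalizing f with
  | zero =>
    have hf : Measurable f := Measurable.of_discrete
    rw [← lintegral_map (f := f) hf (measurable_pi_apply 0), law_map_zero]
    simp
  | succ n ih =>
    rw [lintegral_law_pair p hp ω₀ n fun _ => f, Function.iterate_succ_apply]
    exact ih (nextExpect p hp f)

theorem ae_mem_support_step (ω₀ : Config) :
    ∀ᵐ path ∂law p hp ω₀, ∀ n, path (n + 1) ∈ (step p hp (path n)).support := by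
  classical
  refine ae_all_iff.2 fun n => ?_
  -- Integrate the indicator of an impossible transition.
  have h := lintegral_law_pair p hp ω₀ n
    fun ω ω' => if ω' ∈ (step p hp ω).support then 0 else 1
  have h0 : ∀ ω, ((step p hp ω).expect
      fun ω' => if ω' ∈ (step p hp ω).support then 0 else 1) = 0 := by
    intro ω
    rw [PMF.expect, ENNReal.tsum_eq_zero]
    intro ω'
    by_cases hω : ω' ∈ (step p hp ω).support
    · simp [hω]
    · rw [(PMF.apply_eq_zero_iff _ _).2 hω, zero_mul]
  simp only [h0, lintegral_zero] at h
  have hm : Measurable fun path : ℕ → Config =>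
      if path (n + 1) ∈ (step p hp (path n)).support then (0 : ℝ≥0∞) else 1 := by
    have h1 : Measurable fun y : Config × Config =>
        if y.2 ∈ (step p hp y.1).support then (0 : ℝ≥0∞) else 1 := Measurable.of_discrete
    exact h1.comp (g := fun y : Config × Config => _)
      (f := fun path : ℕ → Config => (path n, path (n + 1))) (by fun_prop)
  filter_upwards [(lintegral_eq_zero_iff hm).1 h] with path hpath
  by_contra hc
  simp [hc] at hpath

/-! ### Fixed-point equations above the critical value. -/

/-- A positive decreasing sequence `B` satisfying a second-order differential inequality whose
characteristic polynomial has no real root does not exist. -/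
theorem no_positive_solution_of_discrim_neg {q c : ℝ} (hc : 0 < 1 + c)
    (hd : (1 + q) ^ 2 < 4 * q * (1 + c)) (B : ℕ → ℝ) (hpos : ∀ x, 0 < B x)
    (hanti : ∀ x, B (x + 1) ≤ B x)
    (hrec : ∀ x, q * (B x - B (x + 1)) + c * B (x + 2) ≤ B (x + 1) - B (x + 2)) : False := by
  set r : ℕ → ℝ := fun x => B (x + 1) / B x with hr
  -- The minimum over `t` of `(1 + c)t² - (1 + q)t + q`, positive because the discriminant is
  -- negative.
  set η : ℝ := q - (1 + q) ^ 2 / (4 * (1 + c)) with hη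
  have hη0 : 0 < η := by
    rw [hη, sub_pos, div_lt_iff₀ (by positivity)]
    linarith
  have hrpos : ∀ x, 0 < r x := fun x => div_pos (hpos _) (hpos _)
  have hr1 : ∀ x, r x ≤ 1 := fun x => (div_le_one (hpos x)).2 (hanti x)
  have hquad : ∀ t : ℝ, η ≤ (1 + c) * t ^ 2 - (1 + q) * t + q := by
    intro t
    have h : (1 + c) * t ^ 2 - (1 + q) * t + q - η
        = (1 + c) * (t - (1 + q) / (2 * (1 + c))) ^ 2 := by
      rw [hη]
      field_simp
      ring
    have := mul_nonneg hc.le (sq_nonneg (t - (1 + q) / (2 * (1 + c))))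
    linarith
  -- Dividing `hrec` by `B x` bounds `(1 + c) * (r x - r (x+1)) * r x` below by the quadratic at `r
  -- x`. As `0 < r x ≤ 1`, each ratio drops by a fixed amount, so the ratios eventually become
  -- negative.
  have hstep : ∀ x, r (x + 1) ≤ r x - η / (1 + c) := by
    intro x
    have hB := hpos x
    have hB1 := hpos (x + 1)
    have e1 : B (x + 1) = r x * B x := by simp only [hr]; field_simp
    have e2 : B (x + 2) = r (x + 1) * B (x + 1) := by simp only [hr]; field_simp
    have h1 := hrec x
    rw [e2, e1] at h1
    have h2 : q * (1 - r x) + c * (r (x + 1) * r x) ≤ r x - r (x + 1) * r x := by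
      refine le_of_mul_le_mul_right ?_ hB
      nlinarith [h1]
    have h3 := hquad (r x)
    have h4 : η ≤ (1 + c) * (r x - r (x + 1)) * r x := by nlinarith
    have h5 : 0 ≤ r x - r (x + 1) := by
      by_contra hneg
      push Not at hneg
      have := mul_neg_of_neg_of_pos (mul_neg_of_pos_of_neg hc hneg) (hrpos x)
      linarith
    have h6 : η ≤ (1 + c) * (r x - r (x + 1)) :=
      h4.trans (mul_le_of_le_one_right (mul_nonneg hc.le h5) (hr1 x))
    have h7 : η / (1 + c) ≤ r x - r (x + 1) := by
      rw [div_le_iff₀ hc]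
      linarith
    linarith
  have hlin : ∀ n : ℕ, r n ≤ 1 - n * (η / (1 + c)) := by
    intro n
    induction n with
    | zero => simpa using hr1 0
    | succ n ih =>
      have := hstep n
      push_cast
      linarith
  obtain ⟨n, hn⟩ := exists_nat_gt (1 / (η / (1 + c)))
  rw [div_lt_iff₀ (div_pos hη0 hc)] at hn
  linarith [hlin n, hrpos n]

/-- Near `0` this bounds `1 - exp (-t)` below by a linear function of slope close to `1`. It follows
from `1 - exp (-t) ≥ t / (1 + t)`. -/
theorem one_sub_mul_le_one_sub_exp_neg {t : ℝ} (ht : 0 ≤ t) :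
    (1 - t) * t ≤ 1 - Real.exp (-t) := by
  have h1 : Real.exp (-t) * (1 + t) ≤ 1 := by
    calc Real.exp (-t) * (1 + t) ≤ Real.exp (-t) * Real.exp t := by
          gcongr
          linarith [Real.add_one_le_exp t]
      _ = 1 := by rw [← Real.exp_add]; simp
  nlinarith [mul_nonneg ht (mul_nonneg ht ht), Real.exp_pos (-t), sq_nonneg t]

open Filter Topology in
/-- The fixed-point equations in logarithmic form have no solution when `1 / 5 < q`. -/
theorem no_log_fixed_point {q : ℝ} (hq : 1 / 5 < q) (hq1 : q < 1) (α B : ℕ → ℝ)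
    (hα0 : 0 < α 0) (hB : ∀ x, 0 ≤ B x) (hB1 : ∀ x, B x = B (x + 1) + α (x + 2))
    (hα1 : ∀ x, α (x + 1) = q * α x + (1 - q) * (1 - Real.exp (-B x))) : False := by
  have hα : ∀ x, 0 < α x := by
    intro x
    induction x with
    | zero => exact hα0
    | succ x ih =>
      rw [hα1]
      have h1 : Real.exp (-B x) ≤ 1 := Real.exp_le_one_iff.2 (by linarith [hB x])
      have h2 : 0 < q * α x := mul_pos (by linarith) ih
      have h3 : 0 ≤ (1 - q) * (1 - Real.exp (-B x)) :=
        mul_nonneg (by linarith) (by linarith)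
      linarith
  have hanti : ∀ x, B (x + 1) ≤ B x := fun x => by linarith [hB1 x, hα (x + 2)]
  have hBpos : ∀ x, 0 < B x := fun x => by linarith [hB1 x, hα (x + 2), hB (x + 1)]
  obtain ⟨l, hl⟩ : ∃ l, Tendsto B atTop (𝓝 l) :=
    ⟨_, tendsto_atTop_ciInf (antitone_nat_of_succ_le hanti)
      ⟨0, by rintro _ ⟨x, rfl⟩; exact hB x⟩⟩
  have hl0 : 0 ≤ l := ge_of_tendsto' hl hB
  have hα2 : Tendsto (fun x => α (x + 2)) atTop (𝓝 0) := by
    have h := hl.sub (hl.comp (tendsto_add_atTop_nat 1))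
    rw [sub_self] at h
    refine h.congr fun x => ?_
    simp only [Function.comp]
    linarith [hB1 x]
  have hαt : Tendsto α atTop (𝓝 0) := (tendsto_add_atTop_iff_nat 2).1 hα2
  -- Passing to the limit in `hα1`, where `α → 0`, forces `1 - exp (-l) = 0`.
  have hlim : Tendsto (fun x => α (x + 1)) atTop
      (𝓝 (q * 0 + (1 - q) * (1 - Real.exp (-l)))) := by
    simp only [hα1]
    exact (hαt.const_mul q).add
      ((((Real.continuous_exp.tendsto _).comp hl.neg).const_sub 1).const_mul _)
  have heq := tendsto_nhds_unique hlim ((tendsto_add_atTop_iff_nat 1).2 hαt)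
  have hl1 : l = 0 := by
    have h1 : 1 - Real.exp (-l) = 0 := by
      have h2 : (1 - q) * (1 - Real.exp (-l)) = 0 := by linarith
      exact (mul_eq_zero.1 h2).resolve_left (by linarith)
    have h3 : Real.exp (-l) = 1 := by linarith
    have := Real.exp_eq_one_iff (-l) |>.1 h3
    linarith
  subst hl1
  -- With this `ε` the gap in `hdisc` equals `(5q - 1)(1 - q)(1 - q/2)`, still positive.
  set ε : ℝ := (5 * q - 1) / 8 with hε
  have hε0 : 0 < ε := by rw [hε]; linarith
  have hε1 : ε < 1 := by rw [hε]; linarith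
  obtain ⟨N, hN⟩ := eventually_atTop.1 (hl.eventually (gt_mem_nhds hε0))
  have hdisc : (1 + q) ^ 2 < 4 * q * (1 + (1 - q) * (1 - ε)) := by
    have h1 : 0 < (5 * q - 1) * (1 - q) := mul_pos (by linarith) (by linarith)
    have h2 : 0 < (5 * q - 1) * (1 - q) * (1 - q) := mul_pos h1 (by linarith)
    rw [hε]
    linarith
  -- On the tail `B < ε`; eliminating `α` through `α (x+2) = B x - B (x+1)` leaves a second-order
  -- inequality in `B` alone.
  refine no_positive_solution_of_discrim_neg (q := q) (c := (1 - q) * (1 - ε)) 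
    (by linarith [mul_pos (sub_pos.2 hq1) (sub_pos.2 hε1)]) hdisc (fun x => B (N + x))
    (fun x => hBpos _) (fun x => hanti _) fun x => ?_
  have e1 := hB1 (N + x)
  have e2 := hB1 (N + x + 1)
  have e3 := hα1 (N + x + 2)
  have e4 := one_sub_mul_le_one_sub_exp_neg (hB (N + x + 2))
  have e5 : (1 - ε) * B (N + x + 2) ≤ (1 - B (N + x + 2)) * B (N + x + 2) :=
    mul_le_mul_of_nonneg_right (by linarith [hN (N + x + 2) (by omega)]) (hB _)
  have e6 := mul_le_mul_of_nonneg_left (e5.trans e4) (sub_nonneg.2 hq1.le)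
  simp only [← add_assoc]
  have e7 : α (N + x + 2) = B (N + x) - B (N + x + 1) := by linarith
  have e8 : α (N + x + 3) = B (N + x + 1) - B (N + x + 2) := by linarith
  rw [e8, e7] at e3
  linarith

/-- In the supercritical regime the fixed-point equations force `b` to vanish. -/
theorem fixed_point_eq_zero {q : ℝ} (hq : 1 / 5 < q) (hq1 : q < 1) (a b : ℕ → ℝ)
    (ha0 : a 0 < 1) (hb0 : ∀ x, 0 ≤ b x) (hb1 : ∀ x, b x ≤ 1)
    (hb : ∀ x, b (x + 1) = b (x + 2) * Real.exp (a (x + 2) - 1))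
    (ha : ∀ x, a (x + 1) = q * a x + (1 - q) * b (x + 1)) (x : ℕ) : b (x + 1) = 0 := by
  by_contra hx
  -- A zero at one positive site spreads to all, so otherwise every logarithm is legitimate.
  have hiff : ∀ y, b (y + 1) = 0 ↔ b (y + 2) = 0 := fun y => by
    rw [hb y, mul_eq_zero, or_iff_left (Real.exp_pos _).ne']
  have h1 : b 1 ≠ 0 := by
    induction x with
    | zero => exact hx
    | succ x ih => exact ih fun h => hx ((hiff x).1 h)
  have hne : ∀ y, b (y + 1) ≠ 0 := by
    intro y
    induction y with
    | zero => exact h1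
    | succ y ih => exact fun h => ih ((hiff y).2 h)
  have hpos : ∀ y, 0 < b (y + 1) := fun y => lt_of_le_of_ne (hb0 _) (hne y).symm
  refine no_log_fixed_point hq hq1 (fun y => 1 - a y) (fun y => -Real.log (b (y + 1)))
    (by linarith) (fun y => ?_) (fun y => ?_) fun y => ?_
  · have := Real.log_nonpos (hb0 (y + 1)) (hb1 _)
    linarith
  · rw [hb y, Real.log_mul (hne (y + 1)) (Real.exp_pos _).ne', Real.log_exp]
    ring
  · simp only [neg_neg]
    rw [Real.exp_log (hpos y), ha y]
    ring

/-! ### Branching property and one-step expectations. -/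

/-- The number of particles at the origin. -/
noncomputable def killed (ω : Config) : ℕ := ω.countP fun z => z.2 = 0

theorem step_cons (z : Particle) (ω : Config) :
    step p hp (z ::ₘ ω) = addParticleStep p hp z (step p hp ω) :=
  Multiset.foldr_cons _ _ _ _

theorem expect_step_prod (w : Particle → ℝ≥0∞) (ω : Config) :
    ((step p hp ω).expect fun ω' => (ω'.map w).prod)
      = (ω.map fun z => (particleStep p hp z).expect fun ω' => (ω'.map w).prod).prod := by
  induction ω using Multiset.induction with
  | empty => simp [step, PMF.expect_pure]
  | cons z ω ih =>
    rw [step_cons, Multiset.map_cons, Multiset.prod_cons, ← ih, addParticleStep]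
    simp only [PMF.expect_bind, PMF.expect_pure, Multiset.map_add, Multiset.prod_add,
      PMF.expect_const_mul, PMF.expect_mul_const]

theorem expect_step_sum (h : Particle → ℝ≥0∞) (ω : Config) :
    ((step p hp ω).expect fun ω' => (ω'.map h).sum)
      = (ω.map fun z => (particleStep p hp z).expect fun ω' => (ω'.map h).sum).sum := by
  induction ω using Multiset.induction with
  | empty => simp [step, PMF.expect_pure]
  | cons z ω ih =>
    rw [step_cons, Multiset.map_cons, Multiset.sum_cons, ← ih, addParticleStep]
    simp only [PMF.expect_bind, PMF.expect_pure, Multiset.map_add, Multiset.sum_add,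
      PMF.expect_add, PMF.expect_const]

/-- Particles at the origin reproduce themselves exactly. This monotonicity in time later permits
monotone convergence. -/
theorem killed_le_of_mem_support_step {ω ω' : Config} (h : ω' ∈ (step p hp ω).support) :
    killed ω ≤ killed ω' := by
  induction ω using Multiset.induction generalizing ω' with
  | empty => simp [killed]
  | cons z ω ih =>
    rw [step_cons, addParticleStep] at h
    simp only [PMF.mem_support_bind_iff, PMF.mem_support_pure_iff] at h
    obtain ⟨a, ha, b, hb, rfl⟩ := h
    have hb := ih hb
    simp only [killed, Multiset.countP_add, Multiset.countP_cons] at hb ⊢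
    by_cases hz : z.2 = 0
    · rw [particleStep, if_pos hz, PMF.mem_support_pure_iff] at ha
      subst ha
      have : Multiset.countP (fun z : Particle => z.2 = 0) {z} = 1 := by
        simp [← Multiset.cons_zero, hz]
      rw [if_pos hz]
      omega
    · rw [if_neg hz]
      omega

theorem poisson_one_toPMF_apply (n : ℕ) :
    (poissonMeasure 1).toPMF n = ENNReal.ofReal (Real.exp (-1) / n.factorial) := by
  rw [Measure.toPMF_apply, poissonMeasure_singleton]
  simp

theorem expect_coin (g : Bool → ℝ≥0∞) : (coin p hp).expect g
    = ENNReal.ofReal (pHat p) * g true + ENNReal.ofReal (1 - pHat p) * g false := by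
  rw [PMF.expect, tsum_fintype, Fintype.sum_bool]
  simp [coin]

/-- The law of the displaced offspring of a particle that turns at site `x`. -/
noncomputable def turnedAt (x : ℕ) : PMF Config :=
  turnedOffspring.map fun s => s.map fun j => (j, displace x j)

theorem expect_turnedAt (x : ℕ) (f : Config → ℝ≥0∞) :
    (turnedAt x).expect f = ∑' n : ℕ, ENNReal.ofReal (Real.exp (-1) / n.factorial) *
      f ((PType.two, x + 1) ::ₘ Multiset.replicate n (PType.three, x + 1)) := by
  rw [turnedAt, turnedOffspring, PMF.expect_map, PMF.expect_map, PMF.expect]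
  simp [poisson_one_toPMF_apply, displace]

theorem expect_particleStep_zero (t : PType) (f : Config → ℝ≥0∞) :
    (particleStep p hp (t, 0)).expect f = f {(t, 0)} := by
  rw [particleStep, if_pos rfl, PMF.expect_pure]

theorem expect_particleStep_two (x : ℕ) (f : Config → ℝ≥0∞) :
    (particleStep p hp (PType.two, x + 1)).expect f = (turnedAt (x + 1)).expect f := by
  rw [particleStep, if_neg (Nat.succ_ne_zero x)]
  rfl

theorem expect_particleStep_one_or_three {t : PType} (ht : t ≠ PType.two) (x : ℕ)
    (f : Config → ℝ≥0∞) :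
    (particleStep p hp (t, x + 1)).expect f
      = ENNReal.ofReal (pHat p) * f {(PType.one, x)}
        + ENNReal.ofReal (1 - pHat p) * (turnedAt (x + 1)).expect f := by
  have h : (particleStep p hp (t, x + 1)).expect f = (((coin p hp).bind fun b =>
      if b then PMF.pure {PType.one} else turnedOffspring).map
        fun s => s.map fun j => (j, displace (x + 1) j)).expect f := by
    rw [particleStep, if_neg (Nat.succ_ne_zero x)]
    cases t
    · rfl
    · exact absurd rfl ht
    · rfl
  rw [h, PMF.expect_map, PMF.expect_bind, expect_coin, turnedAt, PMF.expect_map]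
  simp [PMF.expect_pure, displace]

/-- The exponential is the `Poisson(1)` generating function at `f (PType.three, x + 1)`. -/
theorem expect_turnedAt_prod (f : Particle → ℝ) (hf : ∀ z, 0 ≤ f z) (x : ℕ) :
    ((turnedAt x).expect fun ω => (ω.map fun z => ENNReal.ofReal (f z)).prod)
      = ENNReal.ofReal (f (PType.two, x + 1) * Real.exp (f (PType.three, x + 1) - 1)) := by
  set r := f (PType.three, x + 1) with hr
  have hr0 : 0 ≤ r := hf _
  have hsum : HasSum (fun n : ℕ => Real.exp (-1) / n.factorial * (f (PType.two, x + 1) * r ^ n))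
      (f (PType.two, x + 1) * Real.exp (r - 1)) := by
    have h := (NormedSpace.expSeries_div_hasSum_exp r).mul_left
      (f (PType.two, x + 1) * Real.exp (-1))
    rw [← Real.exp_eq_exp_ℝ, mul_assoc, ← Real.exp_add, neg_add_eq_sub] at h
    exact h.congr_fun fun n => by ring
  rw [expect_turnedAt, ← hsum.tsum_eq, ENNReal.ofReal_tsum_of_nonneg _ hsum.summable]
  · refine tsum_congr fun n => ?_
    rw [ENNReal.ofReal_mul (by positivity), ENNReal.ofReal_mul (hf _),
      ENNReal.ofReal_pow hr0]
    simp [hr]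
  · intro n
    have := hf (PType.two, x + 1)
    positivity

theorem tsum_poisson_one_mul_cast :
    ∑' n : ℕ, ENNReal.ofReal (Real.exp (-1) / n.factorial) * (n : ℝ≥0∞) = 1 := by
  rw [tsum_eq_zero_add' ENNReal.summable]
  have h := (poissonMeasure 1).toPMF.tsum_coe
  simp only [poisson_one_toPMF_apply] at h
  simp only [Nat.cast_zero, mul_zero, zero_add]
  rw [← h]
  refine tsum_congr fun n => ?_
  rw [← ENNReal.ofReal_natCast, ← ENNReal.ofReal_mul (by positivity), Nat.factorial_succ]
  congr 1
  push_cast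
  field_simp

theorem expect_turnedAt_sum (h : Particle → ℝ≥0∞) (x : ℕ) :
    ((turnedAt x).expect fun ω => (ω.map h).sum)
      = h (PType.two, x + 1) + h (PType.three, x + 1) := by
  have h1 := (poissonMeasure 1).toPMF.tsum_coe
  simp only [poisson_one_toPMF_apply] at h1
  rw [expect_turnedAt]
  simp only [Multiset.map_cons, Multiset.sum_cons, Multiset.map_replicate,
    Multiset.sum_replicate, nsmul_eq_mul, mul_add, ENNReal.tsum_add, ← mul_assoc]
  rw [ENNReal.tsum_mul_right, ENNReal.tsum_mul_right, h1, tsum_poisson_one_mul_cast, one_mul,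
    one_mul]

/-! ### Evolution of multiplicative functionals. -/

/-- The action of one time step on multiplicative functionals of the configuration. -/
noncomputable def genStep (q : ℝ) (f : Particle → ℝ) : Particle → ℝ
  | (t, 0) => f (t, 0)
  | (PType.two, x + 1) => f (PType.two, x + 2) * Real.exp (f (PType.three, x + 2) - 1)
  | (PType.one, x + 1) => q * f (PType.one, x)
      + (1 - q) * (f (PType.two, x + 2) * Real.exp (f (PType.three, x + 2) - 1))
  | (PType.three, x + 1) => q * f (PType.one, x)
      + (1 - q) * (f (PType.two, x + 2) * Real.exp (f (PType.three, x + 2) - 1))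

theorem genStep_nonneg {q : ℝ} (hq : 0 ≤ q) (hq1 : q ≤ 1) {f : Particle → ℝ}
    (hf : ∀ z, 0 ≤ f z) (z : Particle) : 0 ≤ genStep q f z := by
  have h := sub_nonneg.2 hq1
  have h1 : ∀ x, 0 ≤ f (PType.two, x + 2) * Real.exp (f (PType.three, x + 2) - 1) := fun x =>
    mul_nonneg (hf _) (Real.exp_pos _).le
  have h2 : ∀ x, 0 ≤ q * f (PType.one, x)
      + (1 - q) * (f (PType.two, x + 2) * Real.exp (f (PType.three, x + 2) - 1)) := fun x =>
    add_nonneg (mul_nonneg hq (hf _)) (mul_nonneg h (h1 x))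
  match z with
  | (t, 0) => cases t <;> exact hf _
  | (PType.two, x + 1) => exact h1 x
  | (PType.one, x + 1) => exact h2 x
  | (PType.three, x + 1) => exact h2 x

theorem genStep_mono {q : ℝ} (hq : 0 ≤ q) (hq1 : q ≤ 1) {f g : Particle → ℝ}
    (hf : ∀ z, 0 ≤ f z) (hfg : ∀ z, f z ≤ g z) (z : Particle) :
    genStep q f z ≤ genStep q g z := by
  have h := sub_nonneg.2 hq1
  have h1 : ∀ x, f (PType.two, x + 2) * Real.exp (f (PType.three, x + 2) - 1)
      ≤ g (PType.two, x + 2) * Real.exp (g (PType.three, x + 2) - 1) := fun x =>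
    mul_le_mul (hfg _) (Real.exp_le_exp.2 (sub_le_sub_right (hfg _) 1)) (Real.exp_pos _).le
      ((hf _).trans (hfg _))
  have h2 : ∀ x, q * f (PType.one, x)
      + (1 - q) * (f (PType.two, x + 2) * Real.exp (f (PType.three, x + 2) - 1))
      ≤ q * g (PType.one, x)
      + (1 - q) * (g (PType.two, x + 2) * Real.exp (g (PType.three, x + 2) - 1)) := fun x =>
    add_le_add (mul_le_mul_of_nonneg_left (hfg _) hq) (mul_le_mul_of_nonneg_left (h1 x) h)
  match z with
  | (t, 0) => cases t <;> exact hfg _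
  | (PType.two, x + 1) => exact h1 x
  | (PType.one, x + 1) => exact h2 x
  | (PType.three, x + 1) => exact h2 x

theorem expect_particleStep_prod (f : Particle → ℝ) (hf : ∀ z, 0 ≤ f z) (z : Particle) :
    ((particleStep p hp z).expect fun ω => (ω.map fun z => ENNReal.ofReal (f z)).prod)
      = ENNReal.ofReal (genStep (pHat p) f z) := by
  have hq := pHat_nonneg hp
  have hq1 := sub_nonneg.2 (pHat_le_one hp)
  have h2 : ∀ t, t ≠ PType.two → ∀ x, ((particleStep p hp (t, x + 1)).expect
      fun ω => (ω.map fun z => ENNReal.ofReal (f z)).prod)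
      = ENNReal.ofReal (pHat p * f (PType.one, x) + (1 - pHat p)
        * (f (PType.two, x + 2) * Real.exp (f (PType.three, x + 2) - 1))) := by
    intro t ht x
    rw [expect_particleStep_one_or_three p hp ht, expect_turnedAt_prod f hf,
      ENNReal.ofReal_add (mul_nonneg hq (hf _))
        (mul_nonneg hq1 (mul_nonneg (hf _) (Real.exp_pos _).le)),
      ENNReal.ofReal_mul hq, ENNReal.ofReal_mul hq1]
    simp
  match z with
  | (t, 0) =>
    rw [expect_particleStep_zero]
    cases t <;> simp [genStep]
  | (PType.two, x + 1) =>
    rw [expect_particleStep_two, expect_turnedAt_prod f hf]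
    rfl
  | (PType.one, x + 1) => exact h2 _ (by simp) x
  | (PType.three, x + 1) => exact h2 _ (by simp) x

theorem iterate_genStep_nonneg {q : ℝ} (hq : 0 ≤ q) (hq1 : q ≤ 1) {f : Particle → ℝ}
    (hf : ∀ z, 0 ≤ f z) (n : ℕ) (z : Particle) : 0 ≤ (genStep q)^[n] f z := by
  induction n generalizing z with
  | zero => exact hf z
  | succ n ih =>
    rw [Function.iterate_succ_apply']
    exact genStep_nonneg hq hq1 ih z

theorem iterate_nextExpect_prod (f : Particle → ℝ) (hf : ∀ z, 0 ≤ f z) (n : ℕ) :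
    (nextExpect p hp)^[n] (fun ω => (ω.map fun z => ENNReal.ofReal (f z)).prod)
      = fun ω => (ω.map fun z => ENNReal.ofReal ((genStep (pHat p))^[n] f z)).prod := by
  induction n with
  | zero => rfl
  | succ n ih =>
    rw [Function.iterate_succ_apply', Function.iterate_succ_apply', ih]
    funext ω
    rw [nextExpect, expect_step_prod]
    simp only [expect_particleStep_prod p hp _
      (iterate_genStep_nonneg (pHat_nonneg hp) (pHat_le_one hp) hf n)]

/-! ### Recurrence for `p > 1/6`. -/

/-- The weight `1 / 2` for every particle at the origin. -/
noncomputable def halfWeight (z : Particle) : ℝ := if z.2 = 0 then 1 / 2 else 1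

theorem halfWeight_nonneg (z : Particle) : 0 ≤ halfWeight z := by
  unfold halfWeight
  split_ifs <;> norm_num

theorem halfWeight_le_one (z : Particle) : halfWeight z ≤ 1 := by
  unfold halfWeight
  split_ifs <;> norm_num

theorem prod_halfWeight (ω : Config) :
    (ω.map fun z => ENNReal.ofReal (halfWeight z)).prod = (2⁻¹ : ℝ≥0∞) ^ killed ω := by
  induction ω using Multiset.induction with
  | empty => simp [killed]
  | cons z ω ih =>
    rw [Multiset.map_cons, Multiset.prod_cons, ih]
    simp only [killed, Multiset.countP_cons]
    by_cases hz : z.2 = 0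
    · have : ENNReal.ofReal (halfWeight z) = 2⁻¹ := by
        rw [halfWeight, if_pos hz, one_div, ENNReal.ofReal_inv_of_pos (by norm_num)]
        norm_num
      rw [this, if_pos hz, pow_succ, mul_comm]
    · rw [halfWeight, if_neg hz, if_neg hz, ENNReal.ofReal_one, one_mul, add_zero]

/-- The constant `1` is fixed by `genStep`, which is monotone, and `halfWeight` equals `1` off the
origin. This starts the monotone iteration. -/
theorem genStep_halfWeight_le {q : ℝ} (hq : 0 ≤ q) (hq1 : q ≤ 1) (z : Particle) :
    genStep q halfWeight z ≤ halfWeight z := by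
  have h := genStep_mono hq hq1 halfWeight_nonneg halfWeight_le_one z
  match z with
  | (t, 0) => cases t <;> exact le_rfl
  | (PType.two, x + 1) => simp [genStep, halfWeight]
  | (PType.one, x + 1) => simpa [genStep, halfWeight] using h
  | (PType.three, x + 1) => simpa [genStep, halfWeight] using h

theorem iterate_genStep_halfWeight_antitone {q : ℝ} (hq : 0 ≤ q) (hq1 : q ≤ 1) (z : Particle) :
    Antitone fun n => (genStep q)^[n] halfWeight z := by
  refine antitone_nat_of_succ_le fun n => ?_
  induction n generalizing z with
  | zero => exact genStep_halfWeight_le hq hq1 z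
  | succ n ih =>
    simp only [Function.iterate_succ_apply'] at ih ⊢
    exact genStep_mono hq hq1 
      (genStep_nonneg hq hq1 (iterate_genStep_nonneg hq hq1 halfWeight_nonneg n)) ih z

open Filter Topology in
theorem tendsto_iterate_genStep_two {q : ℝ} (hq : 1 / 5 < q) (hq1 : q < 1) (x : ℕ) :
    Tendsto (fun n => (genStep q)^[n] halfWeight (PType.two, x + 1)) atTop (𝓝 0) := by
  have hq0 : 0 ≤ q := by linarith
  set F : ℕ → Particle → ℝ := fun n => (genStep q)^[n] halfWeight with hF
  have hF0 : ∀ n z, 0 ≤ F n z := iterate_genStep_nonneg hq0 hq1.le halfWeight_nonneg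
  have hFs : ∀ n, F (n + 1) = genStep q (F n) := fun n => Function.iterate_succ_apply' _ _ _
  set U : Particle → ℝ := fun z => ⨅ n, F n z with hU
  have hlim : ∀ z, Tendsto (fun n => F n z) atTop (𝓝 (U z)) := fun z =>
    tendsto_atTop_ciInf (iterate_genStep_halfWeight_antitone hq0 hq1.le z)
      ⟨0, by rintro _ ⟨n, rfl⟩; exact hF0 n z⟩
  have hU0 : ∀ z, 0 ≤ U z := fun z => ge_of_tendsto' (hlim z) fun n => hF0 n z
  have hU1 : ∀ z, U z ≤ 1 := fun z => le_of_tendsto' (hlim z) fun n =>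
    (iterate_genStep_halfWeight_antitone hq0 hq1.le z n.zero_le).trans (halfWeight_le_one z)
  have hlim1 : ∀ z, Tendsto (fun n => genStep q (F n) z) atTop (𝓝 (U z)) := fun z => by
    simpa only [hFs] using (tendsto_add_atTop_iff_nat 1).2 (hlim z)
  have hlim2 : ∀ y, Tendsto (fun n => F n (PType.two, y + 2)
      * Real.exp (F n (PType.three, y + 2) - 1)) atTop
      (𝓝 (U (PType.two, y + 2) * Real.exp (U (PType.three, y + 2) - 1))) := fun y =>
    (hlim _).mul ((Real.continuous_exp.tendsto _).comp ((hlim _).sub_const 1))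
  have hlim3 : ∀ y, Tendsto (fun n => q * F n (PType.one, y) + (1 - q) * (F n (PType.two, y + 2)
      * Real.exp (F n (PType.three, y + 2) - 1))) atTop
      (𝓝 (q * U (PType.one, y) + (1 - q) *
        (U (PType.two, y + 2) * Real.exp (U (PType.three, y + 2) - 1)))) := fun y =>
    ((hlim _).const_mul q).add ((hlim2 y).const_mul (1 - q))
  have e2 : ∀ y, U (PType.two, y + 1)
      = U (PType.two, y + 2) * Real.exp (U (PType.three, y + 2) - 1) := fun y =>
    tendsto_nhds_unique (hlim1 _) (hlim2 y)
  have e1 : ∀ y, U (PType.one, y + 1) = q * U (PType.one, y) + (1 - q) *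
      (U (PType.two, y + 2) * Real.exp (U (PType.three, y + 2) - 1)) := fun y =>
    tendsto_nhds_unique (hlim1 _) (hlim3 y)
  have e3 : ∀ y, U (PType.three, y + 1) = U (PType.one, y + 1) := fun y =>
    tendsto_nhds_unique (hlim1 (PType.three, y + 1)) (hlim1 (PType.one, y + 1))
  have h0 : ∀ n, F n (PType.one, 0) = 1 / 2 := by
    intro n
    induction n with
    | zero => simp [hF, halfWeight]
    | succ n ih =>
      rw [hFs]
      exact ih
  -- This boundary value excludes the trivial fixed point `1`.
  have e0 : U (PType.one, 0) = 1 / 2 := by simp [hU, h0]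
  have hzero := fixed_point_eq_zero hq hq1 (fun y => U (PType.one, y))
    (fun y => U (PType.two, y)) (by rw [e0]; norm_num) (fun y => hU0 _) (fun y => hU1 _)
    (fun y => by rw [e2, e3]) (fun y => by rw [e1, ← e2]) x
  rw [← hzero]
  exact hlim _

open Filter Topology in
theorem recurrent_of_lt (h6 : 1 / 6 < p) (ω₀ : Config)
    (hω₀ : ∃ x : ℕ, 0 < x ∧ (PType.two, x) ∈ ω₀) : Recurrent p hp ω₀ := by
  obtain ⟨x, hx, hmem⟩ := hω₀
  obtain ⟨x, rfl⟩ := Nat.exists_eq_add_of_lt hx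
  rw [zero_add] at hmem
  have hp1 : 0 < 1 - p := by linarith [hp.2]
  have hq : 1 / 5 < pHat p := by
    rw [pHat, lt_div_iff₀ hp1]
    linarith
  have hq1 : pHat p < 1 := by
    rw [pHat, div_lt_one hp1]
    linarith [hp.2]
  have hq0 := pHat_nonneg hp
  have hbound : ∀ n, ∫⁻ path, (2⁻¹ : ℝ≥0∞) ^ killed (path n) ∂law p hp ω₀
      ≤ ENNReal.ofReal ((genStep (pHat p))^[n] halfWeight (PType.two, x + 1)) := by
    intro n
    rw [lintegral_law p hp ω₀ n fun ω => (2⁻¹ : ℝ≥0∞) ^ killed ω]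
    simp only [← prod_halfWeight]
    rw [iterate_nextExpect_prod p hp _ halfWeight_nonneg]
    obtain ⟨ω, rfl⟩ := Multiset.exists_cons_of_mem hmem
    simp only [Multiset.map_cons, Multiset.prod_cons]
    -- All other initial particles contribute factors at most `1`, so the Type-2 particle alone
    -- controls the bound.
    refine mul_le_of_le_one_right' ((Multiset.prod_le_pow_card _ 1 fun y hy => ?_).trans_eq
      (one_pow _))
    obtain ⟨z, -, rfl⟩ := Multiset.mem_map.1 hy
    exact ENNReal.ofReal_le_one.2 ((iterate_genStep_halfWeight_antitone hq0 hq1.le z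
      n.zero_le).trans (halfWeight_le_one z))
  have hnull : ∀ k : ℕ, law p hp ω₀ {path | ∀ n, killed (path n) ≤ k} = 0 := by
    intro k
    have hle : ∀ n, law p hp ω₀ {path | ∀ n, killed (path n) ≤ k}
        ≤ 2 ^ k * ENNReal.ofReal ((genStep (pHat p))^[n] halfWeight (PType.two, x + 1)) := by
      intro n
      have hm : Measurable fun path : ℕ → Config => (2⁻¹ : ℝ≥0∞) ^ killed (path n) :=
        (Measurable.of_discrete (f := fun ω : Config => (2⁻¹ : ℝ≥0∞) ^ killed ω)).comp
          (measurable_pi_apply n)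
      -- Markov's inequality: at most `k` killed particles means `2^(-killed) ≥ 2^(-k)`.
      have hmark := mul_meas_ge_le_lintegral (μ := law p hp ω₀) hm (2⁻¹ ^ k)
      have hsub : law p hp ω₀ {path | ∀ n, killed (path n) ≤ k}
          ≤ law p hp ω₀ {path | 2⁻¹ ^ k ≤ (2⁻¹ : ℝ≥0∞) ^ killed (path n)} :=
        measure_mono fun path hpath => pow_le_pow_right_of_le_one' (ENNReal.inv_le_one.2 one_le_two) (hpath n)
      calc law p hp ω₀ {path | ∀ n, killed (path n) ≤ k}
          ≤ 2 ^ k * (2⁻¹ ^ k * law p hp ω₀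
            {path | 2⁻¹ ^ k ≤ (2⁻¹ : ℝ≥0∞) ^ killed (path n)}) := by
            rw [← mul_assoc, ← mul_pow, ENNReal.mul_inv_cancel (by simp) (by simp), one_pow,
              one_mul]
            exact hsub
        _ ≤ _ := by gcongr; exact hmark.trans (hbound n)
    have hlim : Tendsto (fun n => 2 ^ k * ENNReal.ofReal ((genStep (pHat p))^[n] halfWeight
        (PType.two, x + 1))) atTop (𝓝 (2 ^ k * ENNReal.ofReal 0)) :=
      ENNReal.Tendsto.const_mul (ENNReal.tendsto_ofReal (tendsto_iterate_genStep_two hq hq1 x))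
        (Or.inr (by simp))
    have := ge_of_tendsto' hlim hle
    simpa using this
  have hcompl : law p hp ω₀ {path | V path = ⊤}ᶜ = 0 := by
    refine measure_mono_null (t := ⋃ k : ℕ, {path | ∀ n, killed (path n) ≤ k}) ?_
      (measure_iUnion_null hnull)
    intro path hpath
    obtain ⟨k, hk⟩ := ENat.ne_top_iff_exists.1 hpath
    refine Set.mem_iUnion.2 ⟨k, fun n => ?_⟩
    have h : ((killed (path n) : ℕ) : ℕ∞) ≤ V path :=
      le_iSup (fun t => (killed (path t) : ℕ∞)) n
    rw [← hk] at h
    exact_mod_cast h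
  refine le_antisymm prob_le_one ?_
  calc (1 : ℝ≥0∞) = law p hp ω₀ ({path | V path = ⊤} ∪ {path | V path = ⊤}ᶜ) := by
        rw [Set.union_compl_self, measure_univ]
    _ ≤ law p hp ω₀ {path | V path = ⊤} + law p hp ω₀ {path | V path = ⊤}ᶜ :=
        measure_union_le _ _
    _ = law p hp ω₀ {path | V path = ⊤} := by rw [hcompl, add_zero]

/-! ### Transience for `p ≤ 1/6`. -/

/-- A weight of particles that is superharmonic for `p ≤ 1 / 6`. -/
noncomputable def superWeight (z : Particle) : ℝ :=
  (if z.1 = PType.two then 1 else 2) * (1 / 3) ^ z.2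

theorem superWeight_nonneg (z : Particle) : 0 ≤ superWeight z := by
  unfold superWeight
  split_ifs <;> positivity

theorem expect_particleStep_superWeight_le (h6 : p ≤ 1 / 6) (z : Particle) :
    ((particleStep p hp z).expect fun ω => (ω.map fun z => ENNReal.ofReal (superWeight z)).sum)
      ≤ ENNReal.ofReal (superWeight z) := by
  have hp1 : 0 < 1 - p := by linarith [hp.2]
  have hq : pHat p ≤ 1 / 5 := by
    rw [pHat, div_le_iff₀ hp1]
    linarith
  have hq0 := pHat_nonneg hp
  -- A Type-2 particle and on average one Type-3 particle at `x + 2` weigh `(1 + 2) * 3^(-(x+2))`;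
  -- hence the weight is exactly harmonic for Type 2.
  have hturn : ∀ x, ((turnedAt (x + 1)).expect
      fun ω => (ω.map fun z => ENNReal.ofReal (superWeight z)).sum)
      = ENNReal.ofReal ((1 / 3) ^ (x + 1)) := by
    intro x
    rw [expect_turnedAt_sum, ← ENNReal.ofReal_add (superWeight_nonneg _) (superWeight_nonneg _)]
    congr 1
    simp only [superWeight, if_true, reduceCtorEq, if_false]
    ring
  have hother : ∀ t, t ≠ PType.two → ∀ x, ((particleStep p hp (t, x + 1)).expect
      fun ω => (ω.map fun z => ENNReal.ofReal (superWeight z)).sum)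
      ≤ ENNReal.ofReal (superWeight (t, x + 1)) := by
    intro t ht x
    rw [expect_particleStep_one_or_three p hp ht, hturn, Multiset.map_singleton,
      Multiset.sum_singleton, ← ENNReal.ofReal_mul hq0,
      ← ENNReal.ofReal_mul (sub_nonneg.2 (pHat_le_one hp)),
      ← ENNReal.ofReal_add (mul_nonneg hq0 (superWeight_nonneg _))
        (mul_nonneg (sub_nonneg.2 (pHat_le_one hp)) (by positivity))]
    -- After division by `3^(-(x+1))` this is `6q + (1 - q) ≤ 2`, that is, `q ≤ 1/5`.
    refine ENNReal.ofReal_le_ofReal ?_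
    simp only [superWeight, reduceCtorEq, if_false, ht]
    have h3 : (0 : ℝ) < (1 / 3) ^ x := by positivity
    rw [pow_succ]
    nlinarith [mul_le_mul_of_nonneg_right hq h3.le]
  match z with
  | (t, 0) =>
    rw [expect_particleStep_zero]
    simp
  | (PType.two, x + 1) =>
    rw [expect_particleStep_two, hturn]
    simp [superWeight]
  | (PType.one, x + 1) => exact hother _ (by simp) x
  | (PType.three, x + 1) => exact hother _ (by simp) x

theorem killed_le_superWeight (ω : Config) :
    (killed ω : ℝ≥0∞) ≤ (ω.map fun z => ENNReal.ofReal (superWeight z)).sum := by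
  induction ω using Multiset.induction with
  | empty => simp [killed]
  | cons z ω ih =>
    rw [Multiset.map_cons, Multiset.sum_cons, killed, Multiset.countP_cons, Nat.cast_add,
      add_comm]
    refine add_le_add ?_ ih
    by_cases hz : z.2 = 0
    · rw [if_pos hz, Nat.cast_one, ENNReal.one_le_ofReal, superWeight, hz]
      split_ifs <;> norm_num
    · rw [if_neg hz]
      simp

theorem lintegral_superWeight_le (h6 : p ≤ 1 / 6) (ω₀ : Config) (n : ℕ) :
    ∫⁻ path, ((path n).map fun z => ENNReal.ofReal (superWeight z)).sum ∂law p hp ω₀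
      ≤ (ω₀.map fun z => ENNReal.ofReal (superWeight z)).sum := by
  induction n with
  | zero =>
    rw [lintegral_law p hp ω₀ 0 fun ω => (ω.map fun z => ENNReal.ofReal (superWeight z)).sum]
    exact le_rfl
  | succ n ih =>
    rw [lintegral_law_pair p hp ω₀ n
      fun _ ω => (ω.map fun z => ENNReal.ofReal (superWeight z)).sum]
    refine (lintegral_mono fun path => ?_).trans ih
    simp only [expect_step_sum]
    exact Multiset.sum_map_le_sum_map _ _ fun z _ =>
      expect_particleStep_superWeight_le p hp h6 z

/-- The argument gives more: `V` is almost surely finite, its mean being at most the initial total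
weight. -/
theorem transient_of_le (h6 : p ≤ 1 / 6) (ω₀ : Config) : Transient p hp ω₀ := by
  set H : Config → ℝ≥0∞ := fun ω => (ω.map fun z => ENNReal.ofReal (superWeight z)).sum with hH
  have hfin : ∀ ω, H ω < ⊤ := by
    intro ω
    induction ω using Multiset.induction with
    | empty => simp [hH]
    | cons z ω ih =>
      simp only [hH, Multiset.map_cons, Multiset.sum_cons] at ih ⊢
      exact ENNReal.add_lt_top.2 ⟨ENNReal.ofReal_lt_top, ih⟩
  have hm : ∀ n, Measurable fun path : ℕ → Config => (killed (path n) : ℝ≥0∞) := fun n =>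
    (Measurable.of_discrete (f := fun ω : Config => (killed ω : ℝ≥0∞))).comp
      (measurable_pi_apply n)
  have hmono : ∀ᵐ path ∂law p hp ω₀, Monotone fun n => (killed (path n) : ℝ≥0∞) := by
    filter_upwards [ae_mem_support_step p hp ω₀] with path hpath
    exact monotone_nat_of_le_succ fun n =>
      Nat.cast_le.2 (killed_le_of_mem_support_step p hp (hpath n))
  have hint : ∫⁻ path, ⨆ n, (killed (path n) : ℝ≥0∞) ∂law p hp ω₀ < ⊤ := by
    rw [lintegral_iSup' (fun n => (hm n).aemeasurable) hmono]
    refine (iSup_le fun n => ?_).trans_lt (hfin ω₀)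
    exact (lintegral_mono fun _ => killed_le_superWeight _).trans
      (lintegral_superWeight_le p hp h6 ω₀ n)
  have hae := ae_lt_top (Measurable.iSup hm) hint.ne
  intro hrec
  have hzero : law p hp ω₀ {path | V path = ⊤} = 0 := by
    refine measure_mono_null (fun path (hpath : V path = ⊤) => ?_) (ae_iff.1 hae)
    simp only [Set.mem_ofPred_eq, not_lt, top_le_iff]
    refine ENNReal.eq_top_of_forall_nnreal_le fun r => ?_
    obtain ⟨k, hk⟩ := exists_nat_gt r
    obtain ⟨n, hn⟩ := lt_iSup_iff.1 (hpath ▸ ENat.natCast_lt_top k : (k : ℕ∞) < V path)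
    have hn' : k ≤ killed (path n) := by exact_mod_cast hn.le
    calc (r : ℝ≥0∞) ≤ (k : ℝ≥0∞) := by exact_mod_cast hk.le
      _ ≤ (killed (path n) : ℝ≥0∞) := Nat.cast_le.2 hn'
      _ ≤ _ := le_iSup (fun n => (killed (path n) : ℝ≥0∞)) n
  rw [Recurrent, hzero] at hrec
  exact zero_ne_one hrec

end NBBRW

theorem mainTheorem7 (p : ℝ) (hp : p ∈ Set.Ioo (0 : ℝ) (1 / 2)) (ω₀ : Config)
    (hω₀ : ∃ x : ℕ, 0 < x ∧ (PType.two, x) ∈ ω₀) :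
    NBBRW.Transient p hp ω₀ ↔ p ≤ 1 / 6 := by
  refine ⟨fun h => ?_, fun h => NBBRW.transient_of_le p hp h ω₀⟩
  by_contra h6
  exact h (NBBRW.recurrent_of_lt p hp (not_le.1 h6) ω₀ hω₀)
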